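/- **Setting.** Let $\mathcal X\subset\mathbb R$ be compact, $x_1,x_2,\ldots\in\mathcal X$ fixed covariates, and let real responses $y_{ij}$ ($i,j\ge 1$) be random variables on a probability space $(\Omega,\mathcal F,P)$; put $\mathbf Y_{nm}=(y_{ij})_{i\le n,j\le m}$, $\mathbf y_i=(y_{i1},\ldots,y_{im})$, $\mathbf X_n=(x_1,\ldots,x_n)$. "Almost surely" refers to $P$; no relation between $P$ and the model below is assumed (misspecification is allowed) except the conditions stated. A model $\mathcal M_k$ consists of a complete separable metric parameter space $\Theta_k$ with a prior probability $\pi$ on its Borel sets, conditional densities $f(y_{ij}\mid\theta,x_i,y_{1j},\ldots,y_{i-1,j})$ with respect to a $\sigma$-finite measure on $\mathbb R$ (independent over $j$ given $\theta$), regression functions $\eta=\eta_\theta$, a transformation $H$ (all measurable), and, for the unknown covariate $\tilde x_i$ given $\theta$, the uniform prior on $$B_{im}(\theta)=\Big\{x\in\mathcal X: H(\eta_\theta(x))\in\big[\bar y_i-\tfrac{c_0s_i}{\sqrt m},\ \bar y_i+\tfrac{c_0s_i}{\sqrt m}\big]\Big\},\qquad c_0\ge 1,$$ where $\bar y_i,s_i$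 are the sample mean and standard deviation (divisor $m-1$) of $\mathbf y_i$. (Where $B_{im}(\theta)$ is Lebesgue-null, the prior may be any probability on $\mathcal X$, measurably in $\theta$.) Let $f(\mathbf y_i\mid\theta,x)=\prod_{j\le m} f(y_{ij}\mid\theta,x,y_{1j},\ldots,y_{i-1,j})$, let $\pi(\tilde x_i\mid\theta,\mathbf y_i)\propto f(\mathbf y_i\mid\theta,\tilde x_i)\,\pi(\tilde x_i\mid\theta)$, and let $$\pi(d\theta\mid\mathbf X_{n,-i},\mathbf Y_{nm})\propto\Big[\prod_{l\le n,\,l\ne i}f(\mathbf y_l\mid\theta,x_l)\Big]\Big[\int f(\mathbf y_i\mid\theta,x)\,\pi(dx\mid\theta)\Big]\pi(d\theta).$$ For a measurable $\tilde\Theta_k\subseteq\Theta_k$ the restricted cross-validation posterior of $\tilde x_i$ is $$\pi(\tilde x_i\mid\mathbf X_{n,-i},\mathbf Y_{nm},\mathcal M_k,\tilde\Theta_k)=\frac{\int_{\tilde\Theta_k}\pi(\tilde x_i\mid\theta,\mathbf y_i)\,d\pi(\theta\mid\mathbf X_{n,-i},\mathbf Y_{nm})}{\pi(\tilde\Theta_k\mid\mathbf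 X_{n,-i},\mathbf Y_{nm})},$$ with mean $E_{i}$ and variance $V_{i}$ (depending on $n,m$ and the data). Let $\tilde{\mathbf X}_n=(\tilde x_1,\ldots,\tilde x_n)$ have, given the data, independent coordinates with these distributions. For $c>0$ and $\mathbf v\in\mathbb R^n$ let $$T_1^{(k)}(\mathbf v)=\frac1n\sum_{i=1}^n\frac{|v_i-E_i|}{\sqrt{V_i+c}},\qquad T_2^{(k)}(\mathbf v)=\frac1n\sum_{i=1}^n\frac{(v_i-E_i)^2}{V_i+c}.$$ **Conditions.** (1) For every fixed $m>1$ the sequence $\mathbf y_1,\mathbf y_2,\ldots$ satisfies Shalizi's conditions with some $h_k:\Theta_k\to[0,\infty]$ (which may depend on $m$). In detail, the true law of $\mathbf Y_{nm}$ has a density $f_{\theta_0}$ with respect to the product dominating measure and, with $R_n(\theta)=f_\theta(\mathbf Y_{nm})/f_{\theta_0}(\mathbf Y_{nm})$ and $h_k(A)=\operatorname{ess\,inf}_{\theta\in A}h_k(\theta)$ (with respect to $\pi$): (S1) $R_n(\theta)$ is jointly measurable in $(\mathbf Y_{nm},\theta)$; (S2) $h_k(\theta)=\lim_n n^{-1}E\log\{f_{\theta_0}(\mathbf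 Y_{nm})/f_\theta(\mathbf Y_{nm})\}$ for every $\theta$, and $h_k$ is measurable; (S3) for every $\theta$, almost surely $n^{-1}\log R_n(\theta)\to-h_k(\theta)$; (S4) $\pi(h_k=\infty)<1$; and there are measurable sets $\mathcal G_n\to\Theta_k$ (every $\theta$ lies in $\mathcal G_n$ for all large $n$) such that (S5) $\pi(\mathcal G_n)\ge1-\zeta e^{-\gamma n}$ for some $\zeta>0$, $\gamma>2h_k(\Theta_k)$, the convergence in (S3) is almost surely uniform over $\mathcal G_n\setminus\{h_k=\infty\}$, and $h_k(\mathcal G_n)\to h_k(\Theta_k)$; (S6) for every $\delta>0$, almost surely, for all large $n$ and all $n'\ge n$, $\frac1{n'}\log\int_{\mathcal G_n}R_{n'}d\pi\le\delta+\limsup_r\frac1r\log\int_{\mathcal G_n}R_rd\pi$; (S7) $h_k(\mathcal G_n\cap A)\to h_k(A)$ for every measurable $A$ with $\pi(A)>0$. (2) There is $\tilde\theta_k\in\tilde\Theta_k$ that minimizes $h_k$ over $\Theta_k$ for every $m>1$. (3) Almost surely, for all $n,m>1$ and $i\le n$, the normalizing constant of $\pi(\cdot\mid\mathbf X_{n,-i},\mathbf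 Y_{nm})$ lies in $(0,\infty)$ and $\pi(\tilde\Theta_k\mid\mathbf X_{n,-i},\mathbf Y_{nm})>0$. (4) Almost surely, for all $i$ and all $m>1$, $\theta\mapsto\pi(\tilde x_i\in A\mid\theta,\mathbf y_i)$ is continuous for every Borel $A$ on the set of $\theta$ for which $B_{im}(\theta)$ is not null and $\pi(\tilde x_i\mid\theta,\mathbf y_i)$ has a normalizing constant in $(0,\infty)$, and $x\mapsto f(\mathbf y_i\mid\tilde\theta_k,x)$ is continuous on $\mathcal X$; $\eta_{\tilde\theta_k}$ is one-to-one on $\mathcal X$. (5) For some $\ell\ge0$ and every $i$ there is $x^*_{ik}$, a continuous function of $(x_1,\ldots,x_{i+\ell})$, such that almost surely every neighbourhood of $x_{ik}^*$ contains $B_{im}(\tilde\theta_k)$ for all large $m$. **Theorem.** Assume these conditions. Let $T^{(k)}$ be $T^{(k)}_1$ or $T^{(k)}_2$, and let $a_k\in\mathbb R$ be its limit constant, that is, $\lim_{m\to\infty}\lim_{n\to\infty}T^{(k)}(\mathbf X_n)=a_k$ almost surely. Let $\alpha\in(0,1)$ and let $[\tilde\ell_{knm},\tilde u_{knm}]$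 be $100(1-\alpha)\%$ credible intervals: almost surely, for all $n,m>1$, the posterior probability that $T^{(k)}(\tilde{\mathbf X}_n)\in[\tilde\ell_{knm},\tilde u_{knm}]$ is at least $1-\alpha$. Then for every $\varepsilon>0$, almost surely, $$\lim_{m\to\infty}\lim_{n\to\infty}\pi\Big(T^{(k)}(\tilde{\mathbf X}_n)-T^{(k)}(\mathbf X_n)\notin[\tilde\ell_{knm}-a_k-\varepsilon,\ \tilde u_{knm}-a_k+\varepsilon]\ \Big|\ \mathbf X_n,\mathbf Y_{nm},\mathcal M_k,\tilde\Theta_k\Big)=0.$$ Here an iterated limit $\lim_{m}\lim_{n}$ means that the inner limit exists for all sufficiently large $m$, and that these inner limits converge as $m\to\infty$. -/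

import Mathlib

open MeasureTheory ProbabilityTheory Filter Topology Set
open scoped ENNReal

noncomputable section

/-- The iterated limit `lim_{m → ∞} lim_{n → ∞} u n m = l`: for all large `m` the inner limit
(as `n → ∞`) exists, and the inner limits converge to `l` as `m → ∞`. -/
def HasIteratedLimit (u : ℕ → ℕ → ℝ) (l : ℝ) : Prop :=
  ∃ L : ℕ → ℝ, (∀ᶠ m in atTop, Tendsto (fun n => u n m) atTop (𝓝 (L m))) ∧
    Tendsto L atTop (𝓝 l)

/-- The sets `B m` shrink to `{x}` as `m → ∞`: every neighbourhood of `x` contains `B m` for all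
large `m`. (A set `B m` may be empty, as can happen when `x` is a boundary point.) -/
def ShrinksTo (B : ℕ → Set ℝ) (x : ℝ) : Prop :=
  ∀ δ > 0, ∀ᶠ m in atTop, B m ⊆ Metric.ball x δ

/-- The sample mean of `m` responses. -/
def sampleMean {m : ℕ} (y : Fin m → ℝ) : ℝ := (∑ j, y j) / (m : ℝ)

/-- The sample standard deviation of `m` responses (divisor `m - 1`). -/
def sampleSD {m : ℕ} (y : Fin m → ℝ) : ℝ :=
  Real.sqrt ((∑ j, (y j - sampleMean y) ^ 2) / ((m : ℝ) - 1))

/-- The set `{x ∈ 𝒳 : H (η x) ∈ [ȳ - c s / √m, ȳ + c s / √m]}`. -/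
def priorSet (𝒳 : Set ℝ) (H η : ℝ → ℝ) (c : ℝ) {m : ℕ} (y : Fin m → ℝ) : Set ℝ :=
  {x | x ∈ 𝒳 ∧ H (η x) ∈ Icc (sampleMean y - c * sampleSD y / Real.sqrt m)
    (sampleMean y + c * sampleSD y / Real.sqrt m)}

/-- A Bayesian inverse regression model with parameter space `Θ`. -/
structure InverseModel (Θ : Type*) [MeasurableSpace Θ] where
  /-- the covariate space -/
  covSpace : Set ℝ
  isCompact_covSpace : IsCompact covSpace
  /-- the measure on the response space that dominates all response distributions -/
  ref : Measure ℝ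
  sigmaFinite_ref : SigmaFinite ref
  /-- `dens i past θ x y` is the density, at `y`, of the `i`-th response, given its
  predecessors `past`, the parameter `θ` and the covariate value `x` -/
  dens : (i : ℕ) → (Fin i → ℝ) → Θ → ℝ → ℝ → ℝ≥0∞
  measurable_dens : ∀ i, Measurable
    fun p : (Fin i → ℝ) × Θ × ℝ × ℝ => dens i p.1 p.2.1 p.2.2.1 p.2.2.2
  lintegral_dens : ∀ i past θ, ∀ x ∈ covSpace, ∫⁻ y, dens i past θ x y ∂ref = 1
  /-- the prior on the parameter space -/
  prior : Measure Θ
  isProbabilityMeasure_prior : IsProbabilityMeasure prior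
  /-- the regression function `x ↦ η(x)` that belongs to the parameter -/
  eta : Θ → ℝ → ℝ
  measurable_eta : Measurable fun p : Θ × ℝ => eta p.1 p.2
  /-- the transformation of the regression function -/
  H : ℝ → ℝ
  measurable_H : Measurable H
  /-- the constant in the prior of the unknown covariate -/
  cPrior : ℝ
  one_le_cPrior : 1 ≤ cPrior
  /-- the prior `π(x̃ᵢ | θ)` of the `i`-th covariate; it depends on the `m` responses `yᵢ` -/
  xPrior : (i m : ℕ) → (Fin m → ℝ) → Kernel Θ ℝ
  isMarkovKernel_xPrior : ∀ i m y, IsMarkovKernel (xPrior i m y)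
  xPrior_compl : ∀ i m y θ, xPrior i m y θ covSpaceᶜ = 0
  /-- The prior is uniform on `B_{im}(θ)`. This determines it unless `B_{im}(θ)` is
  Lebesgue-null (then there is no uniform distribution on it); in that degenerate
  case it may be any distribution on the covariate space. -/
  xPrior_eq_uniform : ∀ (i m : ℕ) (y : Fin m → ℝ) (θ : Θ),
    volume (priorSet covSpace H (eta θ) cPrior y) ≠ 0 →
      xPrior i m y θ = ProbabilityTheory.cond volume (priorSet covSpace H (eta θ) cPrior y)

namespace InverseModel

variable {Θ : Type*} [MeasurableSpace Θ] (M : InverseModel Θ)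

/-- The set `B_{im}(θ)`; `D i j` is the `j`-th response at the `i`-th covariate value. -/
def B (i m : ℕ) (D : ℕ → ℕ → ℝ) (θ : Θ) : Set ℝ :=
  priorSet M.covSpace M.H (M.eta θ) M.cPrior (fun j : Fin m => D i j)

/-- `∏ⱼ f(y_{ij} | θ, x, y_{1j}, …, y_{i-1,j})`, the density of `yᵢ = (y_{i1}, …, y_{im})` given
the earlier responses `past`. -/
def blockDens (i m : ℕ) (past : Fin i → Fin m → ℝ) (yi : Fin m → ℝ) (θ : Θ) (x : ℝ) : ℝ≥0∞ :=
  ∏ j, M.dens i (fun l => past l j) θ x (yi j)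

/-- The likelihood `f_θ(Y_{nm})` for the design `x`. -/
def lik (x : ℕ → ℝ) (n m : ℕ) (Y : Fin n → Fin m → ℝ) (θ : Θ) : ℝ≥0∞ :=
  ∏ i : Fin n, M.blockDens i m (fun l => Y (Fin.castLE i.is_lt.le l)) (Y i) θ (x i)

/-- The measure on the space of `n × m` response arrays that dominates all models. -/
def refArray (n m : ℕ) : Measure (Fin n → Fin m → ℝ) :=
  Measure.pi fun _ => Measure.pi fun _ => M.ref

/-- The distribution of `Y_{nm}` under the parameter `θ`. -/
def law (x : ℕ → ℝ) (n m : ℕ) (θ : Θ) : Measure (Fin n → Fin m → ℝ) :=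
  (M.refArray n m).withDensity fun Y => M.lik x n m Y θ

/-! ### Cross-validation posteriors -/

/-- `f(yᵢ | θ, x, Mₖ)` at the data array `D`. -/
def rowDens (i m : ℕ) (D : ℕ → ℕ → ℝ) (θ : Θ) (x : ℝ) : ℝ≥0∞ :=
  M.blockDens i m (fun l j => D l j) (fun j => D i j) θ x

/-- `π(x̃ᵢ | θ)` at the data array `D`. -/
def xPriorAt (i m : ℕ) (D : ℕ → ℕ → ℝ) : Kernel Θ ℝ := M.xPrior i m (fun j => D i j)

/-- The density of `yᵢ` given `θ` when the `i`-th covariate is unknown: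
`∫ f(yᵢ | θ, x̃) π(dx̃ | θ)`. -/
def rowMarginal (i m : ℕ) (D : ℕ → ℕ → ℝ) (θ : Θ) : ℝ≥0∞ :=
  ∫⁻ x, M.rowDens i m D θ x ∂(M.xPriorAt i m D θ)

/-- `π(x̃ᵢ | θ, yᵢ, Mₖ)`. -/
def xPost (i m : ℕ) (D : ℕ → ℕ → ℝ) (θ : Θ) : Measure ℝ :=
  (M.rowMarginal i m D θ)⁻¹ • (M.xPriorAt i m D θ).withDensity (M.rowDens i m D θ)

/-- The likelihood of `θ` based on `X_{n,-i}` and `Y_{nm}`. -/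
def cvLik (x : ℕ → ℝ) (n m i : ℕ) (D : ℕ → ℕ → ℝ) (θ : Θ) : ℝ≥0∞ :=
  (∏ l ∈ (Finset.range n).erase i, M.rowDens l m D θ (x l)) * M.rowMarginal i m D θ

/-- The normalizing constant of `π(θ | X_{n,-i}, Y_{nm})`. -/
def cvEvidence (x : ℕ → ℝ) (n m i : ℕ) (D : ℕ → ℕ → ℝ) : ℝ≥0∞ :=
  ∫⁻ θ, M.cvLik x n m i D θ ∂M.prior

/-- `π(θ | X_{n,-i}, Y_{nm}, Mₖ)`. -/
def cvParamPost (x : ℕ → ℝ) (n m i : ℕ) (D : ℕ → ℕ → ℝ) : Measure Θ :=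
  (M.cvEvidence x n m i D)⁻¹ • M.prior.withDensity (M.cvLik x n m i D)

/-- The inverse cross-validation posterior restricted to `S ⊆ Θ`,
`∫_S π(x̃ᵢ ∈ · | θ, yᵢ) dπ(θ | X_{n,-i}, Y_{nm}) / π(S | X_{n,-i}, Y_{nm})`. -/
def cvPost (S : Set Θ) (x : ℕ → ℝ) (n m i : ℕ) (D : ℕ → ℕ → ℝ) : Measure ℝ :=
  (M.cvParamPost x n m i D S)⁻¹ •
    ((M.cvParamPost x n m i D).restrict S).bind (M.xPost i m D)

/-- The posterior distribution of `X̃ₙ = (x̃₁, …, x̃ₙ)`: the `x̃ᵢ` are drawn separately, each from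
its own restricted cross-validation posterior. -/
def refDist (S : Set Θ) (x : ℕ → ℝ) (n m : ℕ) (D : ℕ → ℕ → ℝ) : Measure (Fin n → ℝ) :=
  Measure.pi fun i : Fin n => M.cvPost S x n m i D

/-- The posteriors of `x̃ᵢ` are well defined: the normalizing constant of the posterior of `θ` is
positive and finite, and that posterior gives `S` positive mass. -/
def CVProper (S : Set Θ) (x : ℕ → ℝ) (n m i : ℕ) (D : ℕ → ℕ → ℝ) : Prop :=
  M.cvEvidence x n m i D ≠ 0 ∧ M.cvEvidence x n m i D ≠ ∞ ∧ M.cvParamPost x n m i D S ≠ 0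

/-! ### Discrepancy measures -/

/-- `E(x̃ᵢ | X_{n,-i}, Y_{nm}, Mₖ, S)`. -/
def cvMean (S : Set Θ) (x : ℕ → ℝ) (n m i : ℕ) (D : ℕ → ℕ → ℝ) : ℝ :=
  ∫ t, t ∂(M.cvPost S x n m i D)

/-- `Var(x̃ᵢ | X_{n,-i}, Y_{nm}, Mₖ, S)`. -/
def cvVar (S : Set Θ) (x : ℕ → ℝ) (n m i : ℕ) (D : ℕ → ℕ → ℝ) : ℝ :=
  ∫ t, (t - M.cvMean S x n m i D) ^ 2 ∂(M.cvPost S x n m i D)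

/-- The discrepancy measure `T₁`, with stabilizing constant `c`. -/
def T₁ (S : Set Θ) (x : ℕ → ℝ) (c : ℝ) (n m : ℕ) (D : ℕ → ℕ → ℝ) (v : Fin n → ℝ) : ℝ :=
  (1 / (n : ℝ)) * ∑ i : Fin n,
    |v i - M.cvMean S x n m i D| / Real.sqrt (M.cvVar S x n m i D + c)

/-- The discrepancy measure `T₂`, with stabilizing constant `c`. -/
def T₂ (S : Set Θ) (x : ℕ → ℝ) (c : ℝ) (n m : ℕ) (D : ℕ → ℕ → ℝ) (v : Fin n → ℝ) : ℝ :=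
  (1 / (n : ℝ)) * ∑ i : Fin n,
    (v i - M.cvMean S x n m i D) ^ 2 / (M.cvVar S x n m i D + c)

/-! ### Shalizi's conditions -/

section Shalizi

variable {Ω : Type*} [MeasurableSpace Ω] (P : Measure Ω) (y : ℕ → ℕ → Ω → ℝ)

/-- The true distribution of `Y_{nm}`. -/
def trueLaw (n m : ℕ) : Measure (Fin n → Fin m → ℝ) :=
  P.map fun ω => (fun (i : Fin n) (j : Fin m) => y i j ω)

/-- The likelihood ratio `Rₙ(θ) = f_θ(Y_{nm}) / f_{θ₀}(Y_{nm})` as a function of `Y_{nm}` and `θ`;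
the denominator is the true density. -/
def likRatio (x : ℕ → ℝ) (n m : ℕ) (Y : Fin n → Fin m → ℝ) (θ : Θ) : ℝ≥0∞ :=
  M.lik x n m Y θ / (trueLaw P y n m).rnDeriv (M.refArray n m) Y

/-- `Rₙ(θ)` at the observed data. -/
def R (x : ℕ → ℝ) (n m : ℕ) (θ : Θ) (ω : Ω) : ℝ≥0∞ :=
  M.likRatio P y x n m (fun i j => y i j ω) θ

/-- `h(A)`, the essential infimum (with respect to the prior) of `h` over `A`. -/
def hInf (h : Θ → ℝ≥0∞) (A : Set Θ) : ℝ≥0∞ := essInf h (M.prior.restrict A)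

/-- `n⁻¹ log ∫_A Rₙ dπ`. -/
def logEvidence (x : ℕ → ℝ) (m : ℕ) (A : Set Θ) (n : ℕ) (ω : Ω) : EReal :=
  ENNReal.log (∫⁻ θ in A, M.R P y x n m θ ω ∂M.prior) / ((n : ℝ) : EReal)

/-- Shalizi's conditions for the sequence `y₁, y₂, …` of response vectors `yᵢ = (y_{i1}, …, y_{im})`
with `m` fixed; `h` is the Kullback-Leibler divergence rate. -/
structure ShaliziConditions (x : ℕ → ℝ) (m : ℕ) (h : Θ → ℝ≥0∞) : Prop where
  /-- the true distribution has a density -/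
  dominated : ∀ n, trueLaw P y n m ≪ M.refArray n m
  /-- joint measurability of the likelihood ratio -/
  measurable_ratio : ∀ n,
    Measurable fun p : (Fin n → Fin m → ℝ) × Θ => M.likRatio P y x n m p.1 p.2
  /-- the divergence rate exists -/
  tendsto_kl : ∀ θ, Tendsto
    (fun n : ℕ => InformationTheory.klDiv (trueLaw P y n m) (M.law x n m θ) / (n : ℝ≥0∞))
    atTop (𝓝 (h θ))
  measurable_rate : Measurable h
  /-- the relative asymptotic equipartition property -/
  equipartition : ∀ θ, ∀ᵐ ω ∂P, Tendsto
    (fun n : ℕ => ENNReal.log (M.R P y x n m θ ω) / ((n : ℝ) : EReal))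
    atTop (𝓝 (-(h θ : EReal)))
  /-- the divergence rate is not almost surely infinite -/
  prior_infinite : M.prior {θ | h θ = ∞} < 1
  /-- There are sieves `G n → Θ` of exponentially small prior complement, on which the
  equipartition is uniform and `h(G n) → h(Θ)`; the random time after which `n⁻¹ log ∫_{G n} Rₙ dπ`
  stays below its limsup plus `δ` is less than `n` for all large `n`; and `h(G n ∩ A) → h(A)`. -/
  sieves : ∃ G : ℕ → Set Θ,
    (∀ n, MeasurableSet (G n)) ∧
    (∀ θ, ∀ᶠ n in atTop, θ ∈ G n) ∧
    (∃ ζ γ : ℝ, 0 < ζ ∧ 2 * M.hInf h univ < ENNReal.ofReal γ ∧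
      ∀ n : ℕ, ENNReal.ofReal (1 - ζ * Real.exp (-γ * n)) ≤ M.prior (G n)) ∧
    (∀ᵐ ω ∂P, ∀ δ : ℝ, 0 < δ → ∀ᶠ n : ℕ in atTop, ∀ θ ∈ G n, h θ ≠ ∞ →
      ((-(h θ).toReal - δ : ℝ) : EReal)
          ≤ ENNReal.log (M.R P y x n m θ ω) / ((n : ℝ) : EReal) ∧
        ENNReal.log (M.R P y x n m θ ω) / ((n : ℝ) : EReal)
          ≤ ((-(h θ).toReal + δ : ℝ) : EReal)) ∧
    Tendsto (fun n => M.hInf h (G n)) atTop (𝓝 (M.hInf h univ)) ∧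
    (∀ δ : ℝ, 0 < δ → ∀ᵐ ω ∂P, ∀ᶠ n : ℕ in atTop, ∀ n' : ℕ, n ≤ n' →
      M.logEvidence P y x m (G n) n' ω
        ≤ (δ : EReal) + limsup (fun r => M.logEvidence P y x m (G n) r ω) atTop) ∧
    (∀ A, MeasurableSet A → 0 < M.prior A →
      Tendsto (fun n => M.hInf h (G n ∩ A)) atTop (𝓝 (M.hInf h A)))

end Shalizi

end InverseModel

end

/-! Fix the data and `m`. Under the posterior, the discrepancy of a draw is an average of `n`
independent terms. Each term lies in an interval `[0, C]` with `C` free of `n`, because the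
covariate space is compact and the denominators are bounded below by the stabilizing constant.
Chebyshev's inequality then puts the discrepancy within `ε / 4` of some constant `b`, except on an
event of probability `O(1 / n)` (`exists_refDist_abs_discrepancy_sub_ge_le`).

A credible interval of posterior mass at least `1 - α` must meet this window once the exceptional
probability drops below `1 - α`. Enlarged by `ε / 2` on each side, it therefore contains the whole
window; the other `ε / 2` absorbs the distance from the observed discrepancy to `a`
(`measureReal_sub_notMem_Icc_le`). Where `b` lies is irrelevant. The inner limit is thus already
zero for each large `m`; large `m` serves only to bring the limit in `n` of the observed discrepancy
close to `a`. -/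

namespace InverseModel

variable {Θ : Type*} [MeasurableSpace Θ] (M : InverseModel Θ)

/-! ### Cross-validation posteriors as probability measures on a compact set -/

lemma measurable_rowDens (i m : ℕ) (D : ℕ → ℕ → ℝ) :
    Measurable fun p : Θ × ℝ => M.rowDens i m D p.1 p.2 := by
  unfold rowDens blockDens
  refine Finset.measurable_prod _ fun j _ => ?_
  exact (M.measurable_dens i).comp (f := fun p : Θ × ℝ =>
    ((fun l : Fin i => D l j), p.1, p.2, D i j)) (by fun_prop)

instance isMarkovKernel_xPriorAt (i m : ℕ) (D : ℕ → ℕ → ℝ) :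
    IsMarkovKernel (M.xPriorAt i m D) :=
  M.isMarkovKernel_xPrior _ _ _

lemma measurable_rowMarginal (i m : ℕ) (D : ℕ → ℕ → ℝ) : Measurable (M.rowMarginal i m D) :=
  (M.measurable_rowDens i m D).lintegral_kernel_prod_right'

lemma measurable_xPost (i m : ℕ) (D : ℕ → ℕ → ℝ) : Measurable (M.xPost i m D) := by
  refine Measure.measurable_of_measurable_coe _ fun A hA => ?_
  have hk : Measurable fun θ =>
      (M.xPriorAt i m D).withDensity (fun θ t => M.rowDens i m D θ t) θ A :=
    Kernel.measurable_coe _ hA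
  convert! (M.measurable_rowMarginal i m D).inv.mul hk using 1
  funext θ
  rw [Pi.mul_apply, Kernel.withDensity_apply (f := M.rowDens i m D) _ (M.measurable_rowDens i m D)]
  rfl

lemma xPost_univ {i m : ℕ} {D : ℕ → ℕ → ℝ} {θ : Θ} (h0 : M.rowMarginal i m D θ ≠ 0)
    (htop : M.rowMarginal i m D θ ≠ ∞) : M.xPost i m D θ univ = 1 := by
  have : (M.xPriorAt i m D θ).withDensity (M.rowDens i m D θ) univ = M.rowMarginal i m D θ := by
    rw [withDensity_apply _ MeasurableSet.univ, Measure.restrict_univ, rowMarginal]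
  rw [xPost, Measure.smul_apply, this, smul_eq_mul, ENNReal.inv_mul_cancel h0 htop]

lemma xPost_compl_covSpace (i m : ℕ) (D : ℕ → ℕ → ℝ) (θ : Θ) :
    M.xPost i m D θ M.covSpaceᶜ = 0 := by
  have : (M.xPriorAt i m D θ).withDensity (M.rowDens i m D θ) M.covSpaceᶜ = 0 :=
    withDensity_absolutelyContinuous _ _ (M.xPrior_compl _ _ _ _)
  rw [xPost, Measure.smul_apply, this, smul_zero]

lemma measurable_cvLik (x : ℕ → ℝ) (n m i : ℕ) (D : ℕ → ℕ → ℝ) :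
    Measurable (M.cvLik x n m i D) := by
  refine Measurable.mul (Finset.measurable_prod _ fun l _ => ?_) (M.measurable_rowMarginal i m D)
  exact (M.measurable_rowDens l m D).comp (f := fun θ : Θ => (θ, x l)) (by fun_prop)

variable {M} {S : Set Θ} {x : ℕ → ℝ} {n m i : ℕ} {D : ℕ → ℕ → ℝ}

lemma CVProper.isProbabilityMeasure_cvParamPost (h : M.CVProper S x n m i D) :
    IsProbabilityMeasure (M.cvParamPost x n m i D) := by
  refine ⟨?_⟩
  have : M.prior.withDensity (M.cvLik x n m i D) univ = M.cvEvidence x n m i D := by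
    rw [withDensity_apply _ MeasurableSet.univ, Measure.restrict_univ, cvEvidence]
  rw [cvParamPost, Measure.smul_apply, this, smul_eq_mul, ENNReal.inv_mul_cancel h.1 h.2.1]

/-- Finite evidence makes the likelihood finite almost everywhere, and the posterior ignores its
zeros. The row marginal is a factor of this finite nonzero product, so it can be neither zero nor
infinite. -/
lemma CVProper.ae_rowMarginal (h : M.CVProper S x n m i D) :
    ∀ᵐ θ ∂(M.cvParamPost x n m i D),
      M.rowMarginal i m D θ ≠ 0 ∧ M.rowMarginal i m D θ ≠ ∞ := by
  refine Measure.ae_smul_measure ?_ _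
  rw [ae_withDensity_iff (M.measurable_cvLik x n m i D)]
  filter_upwards [ae_lt_top (M.measurable_cvLik x n m i D) h.2.1] with θ hfin hne
  rw [cvLik] at hfin hne
  refine ⟨right_ne_zero_of_mul hne, fun htop => hfin.ne ?_⟩
  rw [htop, ENNReal.mul_top (left_ne_zero_of_mul hne)]

/-- Mass could be lost only at parameters where `xPost` fails to normalize, and these are null for
the parameter posterior by `ae_rowMarginal`. -/
lemma CVProper.isProbabilityMeasure_cvPost (h : M.CVProper S x n m i D) :
    IsProbabilityMeasure (M.cvPost S x n m i D) := by
  have := h.isProbabilityMeasure_cvParamPost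
  refine ⟨?_⟩
  have hone : ∫⁻ θ in S, M.xPost i m D θ univ ∂(M.cvParamPost x n m i D)
      = M.cvParamPost x n m i D S := by
    rw [← setLIntegral_one]
    refine lintegral_congr_ae ?_
    filter_upwards [ae_restrict_of_ae h.ae_rowMarginal] with θ hθ
    exact M.xPost_univ hθ.1 hθ.2
  rw [cvPost, Measure.smul_apply,
    Measure.bind_apply MeasurableSet.univ (M.measurable_xPost i m D).aemeasurable, hone,
    smul_eq_mul, ENNReal.inv_mul_cancel h.2.2 (measure_ne_top _ _)]

variable (M S x n m i D) in
lemma ae_mem_covSpace_cvPost : ∀ᵐ t ∂(M.cvPost S x n m i D), t ∈ M.covSpace := by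
  refine Measure.ae_smul_measure ?_ _
  change Measure.bind _ _ M.covSpaceᶜ = 0
  rw [Measure.bind_apply M.isCompact_covSpace.measurableSet.compl
    (M.measurable_xPost i m D).aemeasurable]
  simp [M.xPost_compl_covSpace]

/-- Posterior mean and posterior draws of a covariate differ by at most a constant. -/
lemma exists_abs_sub_cvMean_le (M : InverseModel Θ) (S : Set Θ) (x : ℕ → ℝ) (m : ℕ)
    (D : ℕ → ℕ → ℝ) : ∃ K : ℝ, ∀ n i, M.CVProper S x n m i D →
      ∀ᵐ t ∂(M.cvPost S x n m i D), |t - M.cvMean S x n m i D| ≤ K := by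
  obtain ⟨K, hK⟩ := M.isCompact_covSpace.isBounded.exists_norm_le
  -- `K` bounds the covariate space in norm, hence both draw and mean, uniformly in `n` and `i`.
  refine ⟨K + K, fun n i h => ?_⟩
  have := h.isProbabilityMeasure_cvPost
  have hb : ∀ᵐ t ∂(M.cvPost S x n m i D), ‖t‖ ≤ K := by
    filter_upwards [M.ae_mem_covSpace_cvPost S x n m i D] with t ht using hK t ht
  have hmean : ‖M.cvMean S x n m i D‖ ≤ K := by
    simpa [cvMean] using norm_integral_le_of_norm_le_const hb
  filter_upwards [hb] with t ht
  exact (norm_sub_le _ _).trans (add_le_add ht hmean)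

end InverseModel

/-! ### Concentration of the discrepancy -/

/-- Chebyshev's inequality for the average of independent variables with values in `[0, C]`. -/
lemma exists_pi_abs_average_sub_ge_le {n : ℕ} (hn : 0 < n) (ν : Fin n → Measure ℝ)
    [∀ i, IsProbabilityMeasure (ν i)] (g : Fin n → ℝ → ℝ) (hg : ∀ i, Measurable (g i)) {C : ℝ}
    (hC : ∀ i, ∀ᵐ t ∂(ν i), g i t ∈ Icc 0 C) {δ : ℝ} (hδ : 0 < δ) :
    ∃ b : ℝ, (Measure.pi ν).real {v | δ ≤ |(1 / (n : ℝ)) * ∑ i, g i (v i) - b|}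
      ≤ C ^ 2 / δ ^ 2 / n := by
  have hn' : (0 : ℝ) < n := by exact_mod_cast hn
  have hL : ∀ i, MemLp (g i) 2 (ν i) := fun i =>
    MemLp.of_bound (hg i).aestronglyMeasurable C <| by
      filter_upwards [hC i] with t ht
      rw [Real.norm_of_nonneg ht.1]; exact ht.2
  have hsum : MemLp (∑ i, fun v : Fin n → ℝ => g i (v i)) 2 (Measure.pi ν) :=
    memLp_finsetSum' _ fun i _ =>
      (hL i).comp_measurePreserving (measurePreserving_eval ν i)
  have hvar : Var[∑ i, fun v : Fin n → ℝ => g i (v i); Measure.pi ν] ≤ n * C ^ 2 := by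
    rw [variance_sum_pi hL]
    calc ∑ i, Var[g i; ν i] ≤ ∑ _i : Fin n, C ^ 2 := by
          refine Finset.sum_le_sum fun i _ =>
            (variance_le_sq_of_bounded (hC i) (hg i).aemeasurable).trans ?_
          -- Popoviciu's bound `((C - 0) / 2) ^ 2` is relaxed to `C ^ 2`.
          nlinarith [sq_nonneg C]
      _ = n * C ^ 2 := by simp
  set b := (Measure.pi ν)[∑ i, fun v : Fin n → ℝ => g i (v i)] with hb
  refine ⟨(1 / (n : ℝ)) * b, ?_⟩
  have hset : {v : Fin n → ℝ | δ ≤ |(1 / (n : ℝ)) * ∑ i, g i (v i) - (1 / (n : ℝ)) * b|}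
      = {v | n * δ ≤ |(∑ i, fun v : Fin n → ℝ => g i (v i)) v - b|} := by
    ext v
    simp only [mem_ofPred_eq, Finset.sum_apply]
    rw [← mul_sub, abs_mul, abs_of_pos (by positivity), one_div, inv_mul_eq_div,
      le_div_iff₀ hn', mul_comm δ]
  rw [hset, measureReal_def]
  refine (ENNReal.toReal_mono ENNReal.ofReal_ne_top
    (meas_ge_le_variance_div_sq hsum (mul_pos hn' hδ))).trans ?_
  rw [ENNReal.toReal_ofReal (div_nonneg (variance_nonneg _ _) (sq_nonneg _))]
  calc _ ≤ (n * C ^ 2) / (n * δ) ^ 2 := by gcongr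
    _ = C ^ 2 / δ ^ 2 / n := by field_simp

namespace InverseModel

variable {Θ : Type*} [MeasurableSpace Θ]

lemma cvVar_nonneg (M : InverseModel Θ) (S : Set Θ) (x : ℕ → ℝ) (n m i : ℕ) (D : ℕ → ℕ → ℝ) :
    0 ≤ M.cvVar S x n m i D :=
  integral_nonneg fun _ => sq_nonneg _

/-- For a fixed number of replicates the discrepancy of a posterior draw concentrates
at a constant. -/
lemma exists_refDist_abs_discrepancy_sub_ge_le (M : InverseModel Θ) (S : Set Θ) (x : ℕ → ℝ)
    {c : ℝ} (hc : 0 < c) {T : (n m : ℕ) → (ℕ → ℕ → ℝ) → (Fin n → ℝ) → ℝ}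
    (hT : T = M.T₁ S x c ∨ T = M.T₂ S x c) (m : ℕ) (D : ℕ → ℕ → ℝ) {δ : ℝ} (hδ : 0 < δ) :
    ∃ C : ℝ, ∀ n, 0 < n → (∀ i < n, M.CVProper S x n m i D) →
      ∃ b : ℝ, (M.refDist S x n m D).real {v | δ ≤ |T n m D v - b|} ≤ C / n := by
  obtain ⟨K, hK⟩ := exists_abs_sub_cvMean_le M S x m D
  have hV := M.cvVar_nonneg S x
  rcases hT with rfl | rfl
  -- Since variances are nonnegative, each summand of `T₁` is at most `K / √c`; likewise `K ^ 2 / c`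
  -- for `T₂` below.
  · refine ⟨(K / Real.sqrt c) ^ 2 / δ ^ 2, fun n hn hp => ?_⟩
    have (i : Fin n) : IsProbabilityMeasure (M.cvPost S x n m i D) :=
      (hp i i.2).isProbabilityMeasure_cvPost
    refine exists_pi_abs_average_sub_ge_le hn (fun i : Fin n => M.cvPost S x n m i D)
      (fun i t => |t - M.cvMean S x n m i D| / Real.sqrt (M.cvVar S x n m i D + c))
      (fun i => by fun_prop) (fun i => ?_) hδ
    filter_upwards [hK n i (hp i i.2)] with t ht
    refine ⟨by positivity, ?_⟩
    have h1 : Real.sqrt c ≤ Real.sqrt (M.cvVar S x n m i D + c) :=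
      Real.sqrt_le_sqrt (by linarith [hV n m i D])
    exact div_le_div₀ ((abs_nonneg _).trans ht) ht (Real.sqrt_pos.2 hc) h1
  · refine ⟨(K ^ 2 / c) ^ 2 / δ ^ 2, fun n hn hp => ?_⟩
    have (i : Fin n) : IsProbabilityMeasure (M.cvPost S x n m i D) :=
      (hp i i.2).isProbabilityMeasure_cvPost
    refine exists_pi_abs_average_sub_ge_le hn (fun i : Fin n => M.cvPost S x n m i D)
      (fun i t => (t - M.cvMean S x n m i D) ^ 2 / (M.cvVar S x n m i D + c))
      (fun i => by fun_prop) (fun i => ?_) hδ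
    filter_upwards [hK n i (hp i i.2)] with t ht
    have h0 := hV n m i D
    refine ⟨by positivity, div_le_div₀ (sq_nonneg _) ?_ hc (by linarith)⟩
    rw [← sq_abs (t - _)]
    gcongr

lemma CVProper.isProbabilityMeasure_refDist {M : InverseModel Θ} {S : Set Θ} {x : ℕ → ℝ}
    {n m : ℕ} {D : ℕ → ℕ → ℝ} (hp : ∀ i < n, M.CVProper S x n m i D) :
    IsProbabilityMeasure (M.refDist S x n m D) := by
  have (i : Fin n) : IsProbabilityMeasure (M.cvPost S x n m i D) :=
    (hp i i.2).isProbabilityMeasure_cvPost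
  unfold refDist
  infer_instance

end InverseModel

/-! ### Transfer to credible intervals -/

/-- If `f` lies within `ε / 4` of some constant with high probability and in `[l, u]` with
probability at least `β`, then `f` lies in `[l - ε / 2, u + ε / 2]` with high probability. -/
lemma measureReal_sub_notMem_Icc_le {E : Type*} [MeasurableSpace E] (μ : Measure E)
    [IsFiniteMeasure μ] {f : E → ℝ} {b r β l u a t ε : ℝ}
    (hconc : μ.real {v | ε / 4 ≤ |f v - b|} ≤ r) (hr : r < β)
    (hmass : ENNReal.ofReal β ≤ μ {v | f v ∈ Icc l u}) (ht : |t - a| < ε / 2) :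
    μ.real {v | f v - t ∉ Icc (l - a - ε) (u - a + ε)} ≤ r := by
  -- The interval meets the window around `b`: otherwise its event, of mass at least `β`, would lie
  -- inside the exceptional event of mass at most `r < β`.
  obtain ⟨v, hv, hvb⟩ : ∃ v, f v ∈ Icc l u ∧ |f v - b| < ε / 4 := by
    by_contra! hcon
    have h1 : μ.real {v | f v ∈ Icc l u} ≤ r :=
      (measureReal_mono (fun v hv => hcon v hv)).trans hconc
    have h2 : β ≤ μ.real {v | f v ∈ Icc l u} :=
      (ENNReal.ofReal_le_iff_le_toReal (measure_ne_top _ _)).1 hmass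
    linarith
  -- Off the exceptional event, `f w` and `f v` are both within `ε / 4` of `b`, so they differ by
  -- less than `ε / 2`; replacing `t` by `a` costs another `ε / 2`.
  refine (measureReal_mono fun w hw => ?_).trans hconc
  by_contra hcon
  simp only [mem_ofPred_eq, not_le] at hcon hw
  rw [abs_lt] at hcon hvb ht
  exact hw ⟨by linarith [hv.1], by linarith [hv.2]⟩

theorem mainTheorem9 {Θ : Type*} [MetricSpace Θ] [CompleteSpace Θ]
    [SecondCountableTopology Θ] [MeasurableSpace Θ] [BorelSpace Θ]
    {Ω : Type*} [MeasurableSpace Ω] (P : Measure Ω) [IsProbabilityMeasure P]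
    (M : InverseModel Θ)
    -- the design and the responses
    (x : ℕ → ℝ) (hx : ∀ i, x i ∈ M.covSpace)
    (y : ℕ → ℕ → Ω → ℝ) (hy : ∀ i j, Measurable (y i j))
    -- Shalizi's conditions, with divergence rate `h m` when there are `m` replicates
    (h : ℕ → Θ → ℝ≥0∞) (hS : ∀ m, 1 < m → M.ShaliziConditions P y x m (h m))
    -- the region `S`, which contains a minimizer `θt` of the divergence rate
    (S : Set Θ) (hS_meas : MeasurableSet S) (θt : Θ) (hθt : θt ∈ S)
    (hmin : ∀ m, 1 < m → ∀ θ, h m θt ≤ h m θ)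
    -- the cross-validation posteriors are well defined
    (hproper : ∀ᵐ ω ∂P, ∀ n m i, 1 < n → 1 < m → i < n →
      M.CVProper S x n m i (fun i j => y i j ω))
    -- `π(x̃ᵢ | θ, yᵢ)` is continuous in `θ` (where it is defined)
    (hcont_post : ∀ᵐ ω ∂P, ∀ i m, 1 < m → ∀ A : Set ℝ, MeasurableSet A →
      ContinuousOn (fun θ => M.xPost i m (fun i j => y i j ω) θ A)
        {θ | volume (M.B i m (fun i j => y i j ω) θ) ≠ 0 ∧
          M.rowMarginal i m (fun i j => y i j ω) θ ≠ 0 ∧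
          M.rowMarginal i m (fun i j => y i j ω) θ ≠ ∞})
    -- `f(yᵢ | θt, x̃ᵢ)` is continuous in `x̃ᵢ`
    (hcont_dens : ∀ᵐ ω ∂P, ∀ i m, 1 < m →
      ContinuousOn (fun t => M.rowDens i m (fun i j => y i j ω) θt t) M.covSpace)
    (hinj : InjOn (M.eta θt) M.covSpace)
    -- the limit point `xᵢ*` of `B_{im}(θt)` is a continuous function of `x₁, …, x_{i+ℓ}`
    (ℓ : ℕ) (xstar : (i : ℕ) → (Fin (i + ℓ + 1) → ℝ) → ℝ)
    (hxstar_cont : ∀ i, ContinuousOn (xstar i) {v | ∀ j, v j ∈ M.covSpace})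
    (hxstar : ∀ i, ∀ᵐ ω ∂P,
      ShrinksTo (fun m => M.B i m (fun i j => y i j ω) θt) (xstar i fun j => x j))
    -- the discrepancy measure, its stabilizing constant and its limit constant `a`
    (c : ℝ) (hc : 0 < c)
    (T : (n m : ℕ) → (ℕ → ℕ → ℝ) → (Fin n → ℝ) → ℝ)
    (hT : T = M.T₁ S x c ∨ T = M.T₂ S x c)
    (a : ℝ)
    (ha : ∀ᵐ ω ∂P, HasIteratedLimit
      (fun n m => T n m (fun i j => y i j ω) (fun i : Fin n => x i)) a)
    -- the credible intervals
    (α : ℝ) (hα : α ∈ Ioo (0 : ℝ) 1) (lo up : ℕ → ℕ → Ω → ℝ)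
    (hcred : ∀ᵐ ω ∂P, ∀ n m, 1 < n → 1 < m →
      ENNReal.ofReal (1 - α) ≤ M.refDist S x n m (fun i j => y i j ω)
        {v | T n m (fun i j => y i j ω) v ∈ Icc (lo n m ω) (up n m ω)})
    (ε : ℝ) (hε : 0 < ε) :
    ∀ᵐ ω ∂P, HasIteratedLimit
      (fun n m => (M.refDist S x n m (fun i j => y i j ω)).real
        {v | T n m (fun i j => y i j ω) v - T n m (fun i j => y i j ω) (fun i : Fin n => x i)
          ∉ Icc (lo n m ω - a - ε) (up n m ω - a + ε)}) 0 := by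
  filter_upwards [hproper, ha, hcred] with ω hp ⟨L, hL, hLa⟩ hcr
  refine ⟨fun _ => 0, ?_, tendsto_const_nhds⟩
  filter_upwards [hL, hLa (Metric.ball_mem_nhds a (half_pos hε)), eventually_gt_atTop 1]
    with m hTm hLm hm
  -- `C` may depend on `m` and `ω` but not on `n`, whereas the centre `b` obtained below may change
  -- with `n`.
  obtain ⟨C, hC⟩ := M.exists_refDist_abs_discrepancy_sub_ge_le S x hc hT m
    (fun i j => y i j ω) (δ := ε / 4) (by positivity)
  have hClim : Tendsto (fun n : ℕ => C / (n : ℝ)) atTop (𝓝 0) :=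
    tendsto_const_div_atTop_nhds_zero_nat C
  refine squeeze_zero' (Eventually.of_forall fun _ => measureReal_nonneg) ?_ hClim
  filter_upwards [hTm (Metric.isOpen_ball.mem_nhds hLm), eventually_gt_atTop 1,
    hClim.eventually_lt_const (sub_pos.2 hα.2)] with n hTn hn hsmall
  have hpn : ∀ i < n, M.CVProper S x n m i (fun i j => y i j ω) := fun i hi => hp n m i hn hm hi
  have := InverseModel.CVProper.isProbabilityMeasure_refDist hpn
  obtain ⟨b, hb⟩ := hC n (by lia) hpn
  exact measureReal_sub_notMem_Icc_le _ hb hsmall (hcr n m hn hm) hTn
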